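/- A Moore$(57,2)$ graph is a simple graph with diameter $2$ and girth $5$ that is regular of valency $57$. For a finite simple graph $\Gamma$ with Laplacian matrix $L = D - A$ (where $D$ is the diagonal matrix of vertex degrees and $A$ is the adjacency matrix), the critical group $K(\Gamma)$ is the torsion subgroup of the cokernel $\mathbb{Z}^{V(\Gamma)}/\operatorname{im}(L)$, and $Syl_5(K(\Gamma))$ denotes its Sylow $5$-subgroup. Theorem B. Let $\Gamma$ be a Moore$(57,2)$ graph. Let $e_0$ denote the rank of the Laplacian matrix of $\Gamma$ over a field of characteristic $5$. Then either $3 \le e_0 \le 1520$ and $$Syl_{5}(K(\Gamma)) \cong (\mathbb{Z}/5\mathbb{Z})^{1520-e_{0}} \oplus (\mathbb{Z}/5^{2}\mathbb{Z})^{1732-e_{0}} \oplus (\mathbb{Z}/5^{3}\mathbb{Z})^{e_{0}-3},$$ or $2 \le e_0 \le 1521$ and $$Syl_{5}(K(\Gamma)) \cong (\mathbb{Z}/5\mathbb{Z})^{1521-e_{0}} \oplus (\mathbb{Z}/5^{2}\mathbb{Z})^{1730-e_{0}} \oplus (\mathbb{Z}/5^{3}\mathbb{Z})^{e_{0}-2}.$$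 -/

import Mathlib

/-- `G` is a Moore graph of valency `k` and diameter `d`: a `k`-regular simple graph with
diameter `d` and girth `2 * d + 1`. The extended (`ℕ∞`-valued) diameter and girth are used, so
such a graph is connected and contains a cycle. -/
structure SimpleGraph.IsMoore {V : Type*} (G : SimpleGraph V) [G.LocallyFinite] (k d : ℕ) :
    Prop where
  regular : G.IsRegularOfDegree k
  ediam_eq : G.ediam = (d : ℕ∞)
  egirth_eq : G.egirth = ((2 * d + 1 : ℕ) : ℕ∞)

/-- The critical group of a finite graph: the torsion subgroup of the cokernel
`ℤ^V / im L` of the Laplacian matrix `L`, acting on `ℤ^V` by `x ↦ L x`. -/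
abbrev SimpleGraph.CriticalGroup {V : Type*} [Fintype V] [DecidableEq V] (G : SimpleGraph V)
    [DecidableRel G.Adj] : Type _ :=
  Submodule.torsion ℤ ((V → ℤ) ⧸ LinearMap.range (G.lapMatrix ℤ).mulVecLin)

/-! ### The quadratic equation satisfied by the Laplacian -/

namespace SimpleGraph

variable {V : Type*} {G : SimpleGraph V}

/-! Common-neighbour counts give `L² = 115 L - 3250 + J`, where `J` is the all-ones matrix. On
sum-zero vectors this says `L (115 - L) = 3250 = 5³ · 26`. So 3250 kills `K`, and its Sylow
5-subgroup is a sum of `a`, `b`, `c` cyclic groups of orders 5, 25, 125. Three counts determine `a`,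
`b`, `c`.

Order: the trace gives the multiplicities of the eigenvalues 50 and 65, hence `|K|` as a
determinant, whose 5-part is `5 ^ 4975` (`card_criticalGroup`). So `a + 2b + 3c = 4975`.

5-torsion: `K` is the cokernel of `L` plus 1 at one diagonal entry, a matrix of rank `e₀ + 1` modulo
5 (`card_ker_five_nsmul`). So `a + b + c = 3249 - e₀`.

Elements of order 125: `c` is the exponent of `|25 · Syl₅| = |650 K|`. For `y` of sum zero, `650 y =
L (115 y - L y) / 5` over ℚ, so `650 y` lies in the integral image of `L` exactly when `L y` is
constant modulo 5. Since `L² = J` modulo 5, the image of the sum-zero vectors modulo constants has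
dimension `e₀ - 2` (`card_range_650_nsmul`). So `c = e₀ - 2`, and the other two follow. -/

lemma not_adj_of_three_lt_egirth (hG : 3 < G.egirth) {u v w : V} (huv : G.Adj u v)
    (hvw : G.Adj v w) : ¬ G.Adj w u := by
  intro hwu
  have hc : (Walk.cons huv (.cons hvw (.cons hwu .nil))).IsCycle := by
    have h1 := huv.ne
    have h2 := hvw.ne
    have h3 := hwu.ne
    refine ⟨⟨⟨?_⟩, by simp⟩, ?_⟩ <;> simp <;> grind
  exact absurd (egirth_le_length hc) (not_le.2 (by simpa using hG))

lemma eq_of_four_lt_egirth (hG : 4 < G.egirth) {u v w w' : V} (huv : u ≠ v)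
    (h1 : G.Adj u w) (h2 : G.Adj w v) (h3 : G.Adj u w') (h4 : G.Adj w' v) : w = w' := by
  by_contra hw
  have hc : (Walk.cons h1 (.cons h2 (.cons h4.symm (.cons h3.symm .nil)))).IsCycle := by
    have h1' := h1.ne
    have h2' := h2.ne
    have h3' := h3.ne
    have h4' := h4.ne
    refine ⟨⟨⟨?_⟩, by simp⟩, ?_⟩ <;> simp <;> grind
  exact absurd (egirth_le_length hc) (not_le.2 (by simpa using hG))

lemma exists_adj_adj_of_ediam_le_two (hG : G.ediam ≤ 2) {u v : V} (huv : u ≠ v)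
    (h : ¬ G.Adj u v) : ∃ w, G.Adj u w ∧ G.Adj w v := by
  have hd : G.edist u v ≤ 2 := edist_le_ediam.trans hG
  obtain ⟨p, hp⟩ := exists_walk_of_edist_ne_top (ne_top_of_le_ne_top (by simp) hd)
  have hl : p.length ≤ 2 := by rw [← hp] at hd; exact_mod_cast hd
  match p, hl with
  | .nil, _ => exact absurd rfl huv
  | .cons h1 .nil, _ => exact absurd h1 h
  | .cons h1 (.cons h2 .nil), _ => exact ⟨_, h1, h2⟩
  | .cons _ (.cons _ (.cons _ _)), hl => simp at hl

namespace IsMoore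

variable [Fintype V] [DecidableEq V] [DecidableRel G.Adj] {k : ℕ}

/-- Entries of `A²` count common neighbours: `k` on the diagonal, none for adjacent vertices (no
triangles), and exactly one otherwise (diameter 2 gives existence, the absence of 4-cycles
uniqueness). -/
lemma adjMatrix_mul_self (hG : G.IsMoore k 2) (R : Type*) [CommRing R] :
    G.adjMatrix R * G.adjMatrix R =
      (k - 1 : R) • (1 : Matrix V V R) - G.adjMatrix R + Matrix.of fun _ _ => 1 := by
  have h4 : 4 < G.egirth := by rw [hG.egirth_eq]; norm_num
  have h3 : 3 < G.egirth := lt_trans (by norm_num) h4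
  ext i j
  by_cases hij : i = j
  · subst hij
    rw [adjMatrix_mul_self_apply_self, hG.regular i]
    simp
  simp only [adjMatrix_mul_apply, adjMatrix_apply, Finset.sum_boole, Matrix.add_apply,
    Matrix.sub_apply, Matrix.smul_apply, Matrix.one_apply_ne hij, Matrix.of_apply]
  by_cases ha : G.Adj i j
  · rw [Finset.card_eq_zero.2]
    · simp [ha]
    · ext w
      simp only [Finset.mem_filter, mem_neighborFinset, Finset.notMem_empty, iff_false, not_and]
      exact fun h1 h2 => not_adj_of_three_lt_egirth h3 ha h2.symm h1.symm
  · obtain ⟨w, hw1, hw2⟩ := exists_adj_adj_of_ediam_le_two hG.ediam_eq.le hij ha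
    rw [Finset.card_eq_one.2 ⟨w, ?_⟩]
    · simp [ha]
    · ext x
      simp only [Finset.mem_filter, mem_neighborFinset, Finset.mem_singleton]
      refine ⟨fun h => eq_of_four_lt_egirth h4 hij h.1 h.2 hw1 hw2, ?_⟩
      rintro rfl
      exact ⟨hw1, hw2⟩

omit [DecidableEq V] in
lemma nonempty (hG : G.IsMoore k 2) : Nonempty V := by
  by_contra h
  rw [not_nonempty_iff] at h
  have := hG.egirth_eq
  rw [egirth_eq_top.2 fun v => h.elim v] at this
  exact absurd this (by simp)

/-- Applying the equation for `A²` to the all-ones vector gives `k² = (k - 1) - k + |V|`. -/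
lemma card_eq (hG : G.IsMoore k 2) : Fintype.card V = k ^ 2 + 1 := by
  obtain ⟨v⟩ := hG.nonempty
  have h := congrFun (congrArg (Matrix.mulVec · (Function.const V (1 : ℤ))) (hG.adjMatrix_mul_self ℤ)) v
  simp only [← Matrix.mulVec_mulVec, Matrix.add_mulVec, Matrix.sub_mulVec, Matrix.smul_mulVec,
    Matrix.one_mulVec, Pi.add_apply, Pi.sub_apply] at h
  have h1 : (G.adjMatrix ℤ).mulVec (Function.const V (1 : ℤ)) = Function.const V (k : ℤ) := by
    ext w
    rw [adjMatrix_mulVec_const_apply_of_regular hG.regular, mul_one, Function.const]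
  rw [h1] at h
  have h2 : (G.adjMatrix ℤ).mulVec (Function.const V (k : ℤ)) = Function.const V ((k : ℤ) * k) := by
    ext w
    rw [adjMatrix_mulVec_const_apply_of_regular hG.regular, Function.const]
  rw [h2] at h
  simp [Matrix.mulVec, dotProduct] at h
  zify
  linarith

lemma lapMatrix_eq (hG : G.IsMoore k 2) (R : Type*) [CommRing R] :
    G.lapMatrix R = (k : R) • (1 : Matrix V V R) - G.adjMatrix R := by
  ext i j
  by_cases h : i = j
  · subst h; simp [lapMatrix, degMatrix, hG.regular i]
  · simp [lapMatrix, degMatrix, h]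

lemma lapMatrix_mul_self (hG : G.IsMoore k 2) (R : Type*) [CommRing R] :
    G.lapMatrix R * G.lapMatrix R = (2 * k + 1 : R) • G.lapMatrix R -
      (k ^ 2 + 1 : R) • (1 : Matrix V V R) + Matrix.of fun _ _ => 1 := by
  rw [hG.lapMatrix_eq R, sub_mul, mul_sub, mul_sub, hG.adjMatrix_mul_self R]
  simp only [smul_mul_assoc, mul_smul_comm, mul_one, one_mul]
  module

end IsMoore

end SimpleGraph

/-! ### Ranks and determinants of matrices -/

open Matrix Finset

namespace Matrix

/-- A diagonalisation by transvections survives a field homomorphism, as does the number of nonzero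
diagonal entries. This reduces an arbitrary field of characteristic 5 to `ZMod 5`. -/
lemma rank_map_of_field {n K F : Type*} [Fintype n] [DecidableEq n] [Field K] [Field F]
    (f : K →+* F) (M : Matrix n n K) : (M.map f).rank = M.rank := by
  classical
  obtain ⟨L, L', D, h⟩ := Pivot.exists_list_transvec_mul_diagonal_mul_list_transvec M
  have hu : ∀ L : List (TransvectionStruct n K),
      IsUnit ((L.map TransvectionStruct.toMatrix).prod).det := by
    intro L
    rw [TransvectionStruct.det_toMatrix_prod]
    exact isUnit_one
  set P := (L.map TransvectionStruct.toMatrix).prod with hP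
  set Q := (L'.map TransvectionStruct.toMatrix).prod with hQ
  have hPu := hu L
  have hQu := hu L'
  rw [← hP] at hPu
  rw [← hQ] at hQu
  have hPu' : IsUnit (P.map f).det := by
    have := hPu.map f
    rwa [RingHom.map_det] at this
  have hQu' : IsUnit (Q.map f).det := by
    have := hQu.map f
    rwa [RingHom.map_det] at this
  rw [h, Matrix.map_mul, Matrix.map_mul, rank_mul_eq_left_of_isUnit_det _ _ hQu',
    rank_mul_eq_right_of_isUnit_det _ _ hPu', rank_mul_eq_left_of_isUnit_det _ _ hQu,
    rank_mul_eq_right_of_isUnit_det _ _ hPu, diagonal_map (map_zero f), rank_diagonal,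
    rank_diagonal]
  simp

lemma card_quotient_range_mulVecLin {n : Type*} [Fintype n] [DecidableEq n] (M : Matrix n n ℤ)
    (hM : M.det ≠ 0) :
    Nat.card ((n → ℤ) ⧸ LinearMap.range M.mulVecLin) = M.det.natAbs := by
  have hinj : Function.Injective M.mulVecLin :=
    mulVec_injective_of_det_mem_nonZeroDivisors (mem_nonZeroDivisors_of_ne_zero hM)
  rw [← Submodule.natAbs_det_equiv _ (LinearEquiv.ofInjective M.mulVecLin hinj)]
  congr 1
  rw [← LinearMap.det_toLin', toLin'_apply']
  rfl

/-- Every eigenvalue is `a` or `b`; `i` and `j` count them with multiplicity. -/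
lemma IsHermitian.exists_det_eq_and_trace_eq {n : Type*} [Fintype n] [DecidableEq n]
    {B : Matrix n n ℝ} (hB : B.IsHermitian) {a b : ℝ}
    (h : (B - a • 1) * (B - b • 1) = 0) :
    ∃ i j : ℕ, i + j = Fintype.card n ∧ B.det = a ^ i * b ^ j ∧ B.trace = i * a + j * b := by
  classical
  have hev : ∀ i, hB.eigenvalues i = a ∨ hB.eigenvalues i = b := by
    intro i
    set w := (hB.eigenvectorBasis i).ofLp with hw
    have hw0 : w ≠ 0 := by
      intro h0
      exact hB.eigenvectorBasis.orthonormal.ne_zero i (by ext j; exact congrFun h0 j)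
    have h1 := hB.mulVec_eigenvectorBasis i
    rw [← hw] at h1
    have h2 : ∀ c : ℝ, (B - c • 1) *ᵥ w = (hB.eigenvalues i - c) • w := by
      intro c
      rw [sub_mulVec, h1, smul_mulVec, one_mulVec, sub_smul]
    have h3 := congrArg (· *ᵥ w) h
    simp only [← mulVec_mulVec, zero_mulVec] at h3
    rw [h2, mulVec_smul, h2, smul_smul, smul_eq_zero, or_iff_left hw0, mul_eq_zero, sub_eq_zero,
      sub_eq_zero] at h3
    exact h3.symm
  refine ⟨#{i | hB.eigenvalues i = a}, #{i | ¬ hB.eigenvalues i = a}, ?_, ?_, ?_⟩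
  · exact Finset.card_filter_add_card_filter_not _
  · rw [hB.det_eq_prod_eigenvalues, ← Finset.prod_filter_mul_prod_filter_not _
      (fun i => hB.eigenvalues i = a)]
    congr 1 <;> refine Finset.prod_eq_pow_card fun i hi => ?_
    · exact (Finset.mem_filter.1 hi).2
    · exact (hev i).resolve_left (Finset.mem_filter.1 hi).2
  · rw [hB.trace_eq_sum_eigenvalues, ← Finset.sum_filter_add_sum_filter_not _
      (fun i => hB.eigenvalues i = a), ← nsmul_eq_mul, ← nsmul_eq_mul]
    congr 1 <;> refine Finset.sum_eq_card_nsmul fun i hi => ?_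
    · exact (Finset.mem_filter.1 hi).2
    · exact (hev i).resolve_left (Finset.mem_filter.1 hi).2

lemma det_one_add_vecMulVec {n R : Type*} [Fintype n] [DecidableEq n] [CommRing R] (u w : n → R) :
    (1 + vecMulVec u w).det = 1 + w ⬝ᵥ u := by
  rw [vecMulVec_eq Unit, det_one_add_replicateCol_mul_replicateRow]

/-- The two matrices differ by rank-one factors on the left and right, of determinants `a * n` and
`n`. This links the spectral side, where adding a multiple of `J` moves only one eigenvalue, to the
integral matrix presenting the critical group. -/
lemma det_add_smul_vecMulVec_one {n R : Type*} [Fintype n] [DecidableEq n] [CommRing R]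
    (M : Matrix n n R) (h1 : M *ᵥ 1 = 0) (h2 : 1 ᵥ* M = 0) (v : n) (a : R) :
    (M + a • vecMulVec 1 1).det = a * Fintype.card n ^ 2 *
      (M + vecMulVec (Pi.single v 1) (Pi.single v 1)).det := by
  have key : (1 + vecMulVec (a • 1 - Pi.single v 1) 1) *
      (M + vecMulVec (Pi.single v 1) (Pi.single v 1)) *
      (1 + vecMulVec 1 (1 - Pi.single v 1)) = M + a • vecMulVec 1 1 := by
    have e1 : (1 + vecMulVec (a • 1 - Pi.single v 1) 1) *
        (M + vecMulVec (Pi.single v 1) (Pi.single v 1)) =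
        M + vecMulVec (a • 1) (Pi.single v 1) := by
      rw [add_mul, one_mul, mul_add, vecMulVec_mul, h2, vecMulVec_mul_vecMulVec]
      simp [sub_vecMulVec]
    rw [e1, mul_add, mul_one, add_mul, mul_vecMulVec, h1, vecMulVec_mul_vecMulVec]
    simp [vecMulVec_sub, smul_vecMulVec]
  rw [← key, det_mul, det_mul, det_one_add_vecMulVec, det_one_add_vecMulVec]
  simp [dotProduct_sub, sub_dotProduct]
  ring

end Matrix

/-! ### Counting in finite abelian groups -/

section FiniteAbelian

variable {A B : Type*} [AddCommGroup A] [AddCommGroup B]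

lemma AddEquiv.card_ker_nsmul (e : A ≃+ B) (n : ℕ) :
    Nat.card {x : A // n • x = 0} = Nat.card {x : B // n • x = 0} :=
  Nat.card_congr (e.toEquiv.subtypeEquiv fun x => by
    simp [← map_nsmul])

lemma AddEquiv.card_range_nsmul (e : A ≃+ B) (n : ℕ) :
    Nat.card {x : A // ∃ y, n • y = x} = Nat.card {x : B // ∃ y, n • y = x} :=
  Nat.card_congr (e.toEquiv.subtypeEquiv fun x => by
    constructor
    · rintro ⟨y, rfl⟩
      exact ⟨e y, by simp⟩
    · rintro ⟨y, hy⟩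
      exact ⟨e.symm y, e.injective (by simpa using hy)⟩)

lemma card_ker_nsmul_prod (n : ℕ) :
    Nat.card {x : A × B // n • x = 0} =
      Nat.card {x : A // n • x = 0} * Nat.card {x : B // n • x = 0} := by
  rw [← Nat.card_prod]
  exact Nat.card_congr ((Equiv.subtypeEquivRight fun x => by simp [Prod.ext_iff]).trans
    Equiv.subtypeProdEquivProd)

lemma card_range_nsmul_prod (n : ℕ) :
    Nat.card {x : A × B // ∃ y, n • y = x} =
      Nat.card {x : A // ∃ y, n • y = x} * Nat.card {x : B // ∃ y, n • y = x} := by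
  rw [← Nat.card_prod]
  exact Nat.card_congr ((Equiv.subtypeEquivRight fun x => by simp [Prod.ext_iff]).trans
    Equiv.subtypeProdEquivProd)

lemma card_ker_nsmul_pi (n a : ℕ) :
    Nat.card {x : Fin a → A // n • x = 0} = Nat.card {x : A // n • x = 0} ^ a := by
  rw [Nat.card_congr ((Equiv.subtypeEquivRight fun x => by simp [funext_iff]).trans
    (Equiv.subtypePiEquivPi (p := fun _ (x : A) => n • x = 0))), Nat.card_pi]
  simp

lemma card_range_nsmul_pi (n a : ℕ) :
    Nat.card {x : Fin a → A // ∃ y, n • y = x} = Nat.card {x : A // ∃ y, n • y = x} ^ a := by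
  rw [Nat.card_congr ((Equiv.subtypeEquivRight fun x => by
      simp only [funext_iff, Pi.smul_apply]
      exact ⟨fun ⟨y, h⟩ i => ⟨y i, h i⟩, fun h => ⟨fun i => (h i).choose, fun i =>
        (h i).choose_spec⟩⟩).trans
    (Equiv.subtypePiEquivPi (p := fun _ (x : A) => ∃ y, n • y = x))), Nat.card_pi]
  simp

lemma nonempty_pi_zmod_equiv {ι : Type*} [Finite ι] {n : ι → ℕ} {m : ℕ} (h : ∀ i, n i = m) :
    Nonempty ((∀ i, ZMod (n i)) ≃+ (Fin (Nat.card ι) → ZMod m)) := by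
  obtain rfl : n = fun _ => m := funext h
  exact ⟨(RingEquiv.piCongrLeft (fun _ => ZMod m) (Finite.equivFin ι)).toAddEquiv⟩

/-- A finite abelian group killed by `p ^ 3` is a sum of cyclic groups of orders `p`, `p ^ 2`,
`p ^ 3`. -/
lemma AddCommGroup.exists_equiv_of_pow_three_nsmul [Finite A] {p : ℕ} (hp : p.Prime)
    (hA : ∀ x : A, p ^ 3 • x = 0) :
    ∃ a b c : ℕ, Nonempty (A ≃+ (Fin a → ZMod p) × (Fin b → ZMod (p ^ 2)) ×
      (Fin c → ZMod (p ^ 3))) := by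
  classical
  obtain ⟨ι, _, q, hq, k, ⟨e⟩⟩ := AddCommGroup.equiv_directSum_zmod_of_finite A
  have hdvd : ∀ i, q i ^ k i ∣ p ^ 3 := by
    intro i
    have h := hA (e.symm (DirectSum.of (fun i => ZMod (q i ^ k i)) i 1))
    rw [← map_nsmul, AddEquiv.map_eq_zero_iff, ← map_nsmul] at h
    have h' := DirectSum.of_injective (β := fun i => ZMod (q i ^ k i)) i (h.trans (map_zero _).symm)
    rw [nsmul_one, ZMod.natCast_eq_zero_iff] at h'
    exact h'
  choose l hl hl' using fun i => (Nat.dvd_prime_pow hp).1 (hdvd i)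
  have e1 : A ≃+ ∀ i, ZMod (p ^ l i) :=
    (e.trans (DirectSum.addEquivProd _)).trans
      (AddEquiv.piCongrRight fun i => (ZMod.ringEquivCongr (hl' i)).toAddEquiv)
  let s : {i // ¬ l i = 1} → Prop := fun i => l i = 2
  let t : {i // ¬ s i} → Prop := fun i => l i = 3
  have e2 := (RingEquiv.piEquivPiSubtypeProd (fun i => l i = 1)
    (fun i => ZMod (p ^ l i))).toAddEquiv
  have e3 := (RingEquiv.piEquivPiSubtypeProd s (fun i => ZMod (p ^ l i))).toAddEquiv
  have e4 := (RingEquiv.piEquivPiSubtypeProd t (fun i => ZMod (p ^ l i))).toAddEquiv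
  obtain ⟨f1⟩ := nonempty_pi_zmod_equiv (n := fun i : {i // l i = 1} => p ^ l i) (m := p)
    fun i => by rw [i.2, pow_one]
  obtain ⟨f2⟩ := nonempty_pi_zmod_equiv (n := fun i : {i // s i} => p ^ l i) (m := p ^ 2)
    fun i => by rw [i.2]
  obtain ⟨f3⟩ := nonempty_pi_zmod_equiv (n := fun i : {i // t i} => p ^ l i) (m := p ^ 3)
    fun i => by rw [i.2]
  -- Exponents are at most 3, so what remains after splitting off 1, 2 and 3 is a product of trivial
  -- groups.
  have h0 : ∀ i : {i // ¬ t i}, l i = 0 := by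
    intro i
    have h1 := i.1.1.2
    have h2 : ¬ l i = 2 := i.1.2
    have h3 : ¬ l i = 3 := i.2
    have h4 := hl i
    omega
  have : ∀ i : {i // ¬ t i}, Unique (ZMod (p ^ l i)) := by
    intro i
    rw [h0 i, pow_zero]
    infer_instance
  exact ⟨_, _, _, ⟨e1.trans (e2.trans (f1.prodCongr (e3.trans (f2.prodCongr (e4.trans
    ((AddEquiv.prodUnique).trans f3))))))⟩⟩

lemma card_ker_nsmul_mul_card_range_nsmul (n : ℕ) :
    Nat.card {x : A // n • x = 0} * Nat.card {x : A // ∃ y, n • y = x} = Nat.card A := by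
  have h := (nsmulAddMonoidHom (α := A) n).ker.card_mul_index
  rwa [AddSubgroup.index_ker] at h

/-- The three exponents are linearly independent forms in `a`, `b`, `c`, so these cardinalities
determine the group. -/
lemma AddEquiv.cards_of_zmod_five {a b c : ℕ}
    (e : A ≃+ (Fin a → ZMod 5) × (Fin b → ZMod (5 ^ 2)) × (Fin c → ZMod (5 ^ 3))) :
    Nat.card A = 5 ^ (a + 2 * b + 3 * c) ∧ Nat.card {x : A // 5 • x = 0} = 5 ^ (a + b + c) ∧
      Nat.card {x : A // ∃ y, 25 • y = x} = 5 ^ c := by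
  have h1 : Nat.card {x : ZMod 5 // 5 • x = 0} = 5 := by
    rw [Nat.card_eq_fintype_card]; decide
  have h2 : Nat.card {x : ZMod (5 ^ 2) // 5 • x = 0} = 5 := by
    rw [Nat.card_eq_fintype_card]; decide +kernel
  have h3 : Nat.card {x : ZMod (5 ^ 3) // 5 • x = 0} = 5 := by
    rw [Nat.card_eq_fintype_card]; decide +kernel
  have h4 : Nat.card {x : ZMod 5 // ∃ y, 25 • y = x} = 1 := by
    rw [Nat.card_eq_fintype_card]; decide +kernel
  have h5 : Nat.card {x : ZMod (5 ^ 2) // ∃ y, 25 • y = x} = 1 := by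
    rw [Nat.card_eq_fintype_card]; decide +kernel
  have h6 : Nat.card {x : ZMod (5 ^ 3) // ∃ y, 25 • y = x} = 5 := by
    rw [Nat.card_eq_fintype_card]; decide +kernel
  refine ⟨?_, ?_, ?_⟩
  · rw [Nat.card_congr e.toEquiv]
    simp only [Nat.card_prod, Nat.card_pi, Nat.card_zmod, Finset.prod_const, Finset.card_univ,
      Fintype.card_fin, ← pow_mul, ← pow_add]
    congr 1
    ring
  · rw [e.card_ker_nsmul, card_ker_nsmul_prod, card_ker_nsmul_prod, card_ker_nsmul_pi,
      card_ker_nsmul_pi, card_ker_nsmul_pi, h1, h2, h3, ← pow_add, ← pow_add, add_assoc]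
  · rw [e.card_range_nsmul, card_range_nsmul_prod, card_range_nsmul_prod, card_range_nsmul_pi,
      card_range_nsmul_pi, card_range_nsmul_pi, h4, h5, h6, one_pow, one_pow, one_mul, one_mul]

end FiniteAbelian

/-- An order that is a power of `p` and divides `p ^ n * m` divides `p ^ n`; conversely, in an
abelian group the Sylow subgroup is unique and so contains every `p`-subgroup. -/
lemma Sylow.mem_iff_pow_eq_one {A : Type*} [CommGroup A] [Finite A] {p n m : ℕ} [Fact p.Prime]
    (P : Sylow p A) (h : ∀ x : A, x ^ (p ^ n * m) = 1) (hm : p.Coprime m) (x : A) :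
    x ∈ P ↔ x ^ p ^ n = 1 := by
  constructor
  · intro hx
    obtain ⟨k, hk⟩ := P.isPGroup' ⟨x, hx⟩
    have hk' : x ^ p ^ k = 1 := congrArg Subtype.val hk
    rw [← orderOf_dvd_iff_pow_eq_one] at hk' ⊢
    exact (Nat.Coprime.coprime_dvd_left hk' (hm.pow_left k)).dvd_of_dvd_mul_right
      (orderOf_dvd_iff_pow_eq_one.2 (h x))
  · intro hx
    have hp : IsPGroup p (Subgroup.zpowers x) := by
      rintro ⟨_, k, rfl⟩
      refine ⟨n, Subtype.ext ?_⟩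
      change (x ^ k) ^ p ^ n = 1
      rw [← zpow_natCast, ← _root_.zpow_mul, mul_comm, _root_.zpow_mul, zpow_natCast, hx, _root_.one_zpow]
    obtain ⟨Q, hQ⟩ := hp.exists_le_sylow
    have := (Sylow.unique_of_normal P inferInstance).instSubsingleton
    rw [Subsingleton.elim P Q]
    exact hQ (Subgroup.mem_zpowers x)

/-! ### The critical group as a cokernel of a nonsingular matrix -/

namespace SimpleGraph

variable {V : Type*} [Fintype V] [DecidableEq V] {G : SimpleGraph V} [DecidableRel G.Adj]

lemma lapMatrix_mulVec_one (R : Type*) [CommRing R] : G.lapMatrix R *ᵥ 1 = 0 :=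
  funext fun v => congrFun (G.lapMatrix_mulVec_const_eq_zero (R := R)) v

lemma one_vecMul_lapMatrix (R : Type*) [CommRing R] : 1 ᵥ* G.lapMatrix R = 0 := by
  rw [← mulVec_transpose, (G.isSymm_lapMatrix (R := R)).eq, lapMatrix_mulVec_one]

lemma sum_lapMatrix_mulVec {R : Type*} [CommRing R] (x : V → R) :
    ∑ i, (G.lapMatrix R *ᵥ x) i = 0 := by
  rw [← one_dotProduct, dotProduct_mulVec, one_vecMul_lapMatrix, zero_dotProduct]

lemma lapMatrix_map {R S : Type*} [CommRing R] [CommRing S] (f : R →+* S) :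
    (G.lapMatrix R).map f = G.lapMatrix S := by
  ext i j
  by_cases h : i = j
  · subst h; simp [lapMatrix, degMatrix]
  · by_cases h' : G.Adj i j <;> simp [lapMatrix, degMatrix, h, h']

variable (G) in
/-- The Laplacian matrix with the vertex `v` grounded: `1` is added to its `v`-th diagonal
entry. -/
def groundedLapMatrix (R : Type*) [CommRing R] (v : V) : Matrix V V R :=
  G.lapMatrix R + vecMulVec (Pi.single v 1) (Pi.single v 1)

lemma groundedLapMatrix_map {R S : Type*} [CommRing R] [CommRing S] (f : R →+* S) (v : V) :
    (G.groundedLapMatrix R v).map f = G.groundedLapMatrix S v := by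
  rw [groundedLapMatrix, groundedLapMatrix, Matrix.map_add f (map_add f), lapMatrix_map]
  congr 1
  ext i j
  by_cases h : i = v <;> by_cases h' : j = v <;>
    simp [vecMulVec_apply, h, h']

lemma mem_range_groundedLapMatrix {R : Type*} [CommRing R] {v : V} {y : V → R} :
    y ∈ LinearMap.range (G.groundedLapMatrix R v).mulVecLin ↔
      ∃ (z : V → R) (s : R), y = G.lapMatrix R *ᵥ z + s • (Pi.single v 1 : V → R) := by
  have key : ∀ x : V → R, G.groundedLapMatrix R v *ᵥ x =
      G.lapMatrix R *ᵥ x + x v • Pi.single v 1 := by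
    intro x
    rw [groundedLapMatrix, add_mulVec, vecMulVec_mulVec]
    simp
  constructor
  · rintro ⟨x, rfl⟩
    exact ⟨x, x v, key x⟩
  · rintro ⟨z, s, rfl⟩
    -- Constants lie in the kernel of `L`, so the value at `v` can be set to `s` without changing `L
    -- z`.
    refine ⟨z + (s - z v) • 1, ?_⟩
    rw [mulVecLin_apply, key, mulVec_add, mulVec_smul, lapMatrix_mulVec_one]
    simp

/-- The projection onto the vectors of coordinate sum zero along the basis vector at `v`. -/
def sumZeroProj (R : Type*) [CommRing R] (v : V) : (V → R) →ₗ[R] (V → R) where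
  toFun x := x - (∑ i, x i) • Pi.single v 1
  map_add' x y := by simp [Finset.sum_add_distrib, add_smul]; abel
  map_smul' c x := by simp [← Finset.mul_sum, smul_sub, mul_smul]

lemma sumZeroProj_apply {R : Type*} [CommRing R] (v : V) (x : V → R) :
    sumZeroProj R v x = x - (∑ i, x i) • Pi.single v 1 := rfl

lemma sum_sumZeroProj {R : Type*} [CommRing R] (v : V) (x : V → R) :
    ∑ i, sumZeroProj R v x i = 0 := by
  simp [sumZeroProj_apply, ← Finset.mul_sum]

lemma sumZeroProj_of_sum_eq_zero {R : Type*} [CommRing R] (v : V) {x : V → R}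
    (hx : ∑ i, x i = 0) : sumZeroProj R v x = x := by
  simp [sumZeroProj_apply, hx]

lemma sumZeroProj_mem_range_lapMatrix {R : Type*} [CommRing R] {v : V} {x : V → R} :
    (∃ z, G.lapMatrix R *ᵥ z = sumZeroProj R v x) ↔
      x ∈ LinearMap.range (G.groundedLapMatrix R v).mulVecLin := by
  rw [mem_range_groundedLapMatrix]
  constructor
  · rintro ⟨z, hz⟩
    exact ⟨z, ∑ i, x i, by rw [hz, sumZeroProj_apply, sub_add_cancel]⟩
  · rintro ⟨z, s, rfl⟩
    refine ⟨z, ?_⟩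
    simp [sumZeroProj_apply, Finset.sum_add_distrib, sum_lapMatrix_mulVec, ← Finset.mul_sum]

namespace IsMoore

variable {k : ℕ}

lemma lapMatrix_mulVec_mulVec (hG : G.IsMoore k 2) {R : Type*} [CommRing R] (x : V → R) :
    G.lapMatrix R *ᵥ (G.lapMatrix R *ᵥ x) = (2 * k + 1 : R) • (G.lapMatrix R *ᵥ x) -
      (k ^ 2 + 1 : R) • x + (∑ i, x i) • 1 := by
  rw [mulVec_mulVec, hG.lapMatrix_mul_self, add_mulVec, sub_mulVec, smul_mulVec, smul_mulVec,
    one_mulVec]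
  congr 1
  ext i
  simp [mulVec, dotProduct]

/-- On sum-zero vectors the term `J` vanishes, so `(2k + 1) - L` inverts `L` up to the factor `k² +
1`. -/
lemma lapMatrix_mulVec_of_sum_eq_zero (hG : G.IsMoore k 2) {R : Type*} [CommRing R] {x : V → R}
    (hx : ∑ i, x i = 0) :
    G.lapMatrix R *ᵥ ((2 * k + 1 : R) • x - G.lapMatrix R *ᵥ x) = (k ^ 2 + 1 : R) • x := by
  rw [mulVec_sub, mulVec_smul, hG.lapMatrix_mulVec_mulVec, hx]
  simp

lemma nsmul_mem_torsion (hG : G.IsMoore k 2) (x : V → ℤ) (hx : ∑ i, x i = 0) :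
    (k ^ 2 + 1) • (Submodule.Quotient.mk x : (V → ℤ) ⧸ LinearMap.range
      (G.lapMatrix ℤ).mulVecLin) = 0 := by
  rw [← Submodule.Quotient.mk_smul, Submodule.Quotient.mk_eq_zero]
  refine ⟨_, (hG.lapMatrix_mulVec_of_sum_eq_zero hx).trans ?_⟩
  ext i
  simp

/-- The image of `L` has coordinate sum zero, and ℤ is torsion-free. With `nsmul_mem_torsion`, the
torsion classes are exactly those of sum-zero vectors. -/
lemma sum_eq_zero_of_mem_torsion {x : V → ℤ}
    (hx : (Submodule.Quotient.mk x : (V → ℤ) ⧸ LinearMap.range (G.lapMatrix ℤ).mulVecLin) ∈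
      Submodule.torsion ℤ _) : ∑ i, x i = 0 := by
  rw [Submodule.mem_torsion_iff] at hx
  obtain ⟨⟨a, ha⟩, h⟩ := hx
  change a • (Submodule.Quotient.mk x :
    (V → ℤ) ⧸ LinearMap.range (G.lapMatrix ℤ).mulVecLin) = 0 at h
  rw [← Submodule.Quotient.mk_smul, Submodule.Quotient.mk_eq_zero] at h
  obtain ⟨z, hz⟩ := h
  have h := sum_lapMatrix_mulVec (G := G) z
  rw [← mulVecLin_apply, hz] at h
  simp only [Pi.smul_apply, ← Finset.smul_sum] at h
  exact (smul_eq_zero.1 h).resolve_left (nonZeroDivisors.ne_zero ha)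

lemma nsmul_criticalGroup (hG : G.IsMoore k 2) (x : G.CriticalGroup) : (k ^ 2 + 1) • x = 0 := by
  obtain ⟨x, hx⟩ := x
  obtain ⟨x, rfl⟩ := Submodule.Quotient.mk_surjective _ x
  exact Subtype.ext (hG.nsmul_mem_torsion x (sum_eq_zero_of_mem_torsion hx))

/-- The critical group of a Moore graph of diameter two is the cokernel of a grounded
Laplacian. -/
lemma nonempty_criticalGroup_equiv (hG : G.IsMoore k 2) (v : V) :
    Nonempty (G.CriticalGroup ≃+
      (V → ℤ) ⧸ LinearMap.range (G.groundedLapMatrix ℤ v).mulVecLin) := by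
  let f : (V → ℤ) →ₗ[ℤ] G.CriticalGroup :=
    ((LinearMap.range (G.lapMatrix ℤ).mulVecLin).mkQ.comp (sumZeroProj ℤ v)).codRestrict _ <| by
      intro x
      rw [Submodule.mem_torsion_iff]
      refine ⟨⟨(k ^ 2 + 1 : ℕ), mem_nonZeroDivisors_of_ne_zero (by positivity)⟩, ?_⟩
      change ((k ^ 2 + 1 : ℕ) : ℤ) • (Submodule.Quotient.mk (sumZeroProj ℤ v x) :
        (V → ℤ) ⧸ LinearMap.range (G.lapMatrix ℤ).mulVecLin) = 0
      rw [natCast_zsmul]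
      exact hG.nsmul_mem_torsion _ (sum_sumZeroProj v x)
  have hf : Function.Surjective f := by
    rintro ⟨x, hx⟩
    obtain ⟨x, rfl⟩ := Submodule.Quotient.mk_surjective _ x
    refine ⟨x, Subtype.ext ?_⟩
    change Submodule.Quotient.mk (sumZeroProj ℤ v x) = _
    rw [sumZeroProj_of_sum_eq_zero v (sum_eq_zero_of_mem_torsion hx)]
  have hk : LinearMap.ker f = LinearMap.range (G.groundedLapMatrix ℤ v).mulVecLin := by
    ext x
    rw [← sumZeroProj_mem_range_lapMatrix, LinearMap.mem_ker, Subtype.ext_iff]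
    exact Submodule.Quotient.mk_eq_zero _
  exact ⟨(((Submodule.quotEquivOfEq _ _ hk).symm.trans
    (f.quotKerEquivOfSurjective hf)).symm).toAddEquiv⟩

end IsMoore

end SimpleGraph

/-! ### The order of the critical group -/

namespace SimpleGraph.IsMoore

variable {V : Type*} [Fintype V] [DecidableEq V] {G : SimpleGraph V} [DecidableRel G.Adj]

lemma det_groundedLapMatrix (hG : G.IsMoore 57 2) (v : V) :
    162500 * (G.groundedLapMatrix ℤ v).det = 50 ^ 1730 * 65 ^ 1520 := by
  have hn : Fintype.card V = 3250 := hG.card_eq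
  set J : Matrix V V ℝ := vecMulVec 1 1 with hJ
  have hJ' : (Matrix.of fun _ _ => 1 : Matrix V V ℝ) = J := by ext; simp [J]
  set L := G.lapMatrix ℝ with hL
  have hLJ : L * J = 0 := by rw [hJ, mul_vecMulVec, lapMatrix_mulVec_one, zero_vecMulVec]
  have hJL : J * L = 0 := by rw [hJ, vecMulVec_mul, one_vecMul_lapMatrix, vecMulVec_zero]
  have hJJ : J * J = (3250 : ℝ) • J := by
    rw [hJ, vecMulVec_mul_vecMulVec]
    simp [hn, vecMulVec_smul]
  have hLL : L * L = (115 : ℝ) • L - (3250 : ℝ) • (1 : Matrix V V ℝ) + J := by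
    rw [hL, hG.lapMatrix_mul_self, hJ']
    norm_num
  -- The coefficient 1/65 moves the eigenvalue of the all-ones vector from 0 to 3250/65 = 50, so
  -- only 50 and 65 occur. The factor 162500 in the statement is 3250²/65.
  have hB : (L + (1 / 65 : ℝ) • J).IsHermitian := by
    refine (G.isHermitian_lapMatrix (R := ℝ)).add ?_
    ext i j
    simp [J]
  obtain ⟨i, j, hij, hd, ht⟩ := hB.exists_det_eq_and_trace_eq (a := 50) (b := 65) <| by
    simp only [sub_mul, mul_sub, add_mul, mul_add, smul_mul_assoc, mul_smul_comm, hLJ, hJL, hJJ,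
      hLL, mul_one, one_mul]
    module
  -- 57 · 3250 + 3250/65; together with `i + j = 3250` it fixes the multiplicities.
  have htr : (L + (1 / 65 : ℝ) • J).trace = 185300 := by
    rw [hL, hG.lapMatrix_eq, trace_add, trace_sub, trace_smul, trace_smul, trace_one,
      trace_adjMatrix, hn, hJ, trace_vecMulVec]
    simp [hn]
    norm_num
  rw [htr] at ht
  have ht' : 185300 = i * 50 + j * 65 := by exact_mod_cast ht
  obtain rfl : i = 1730 := by omega
  obtain rfl : j = 1520 := by omega
  rw [det_add_smul_vecMulVec_one L (lapMatrix_mulVec_one ℝ) (one_vecMul_lapMatrix ℝ) v, hn] at hd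
  have hc : (L + vecMulVec (Pi.single v 1) (Pi.single v 1)).det =
      ((G.groundedLapMatrix ℤ v).det : ℝ) := by
    rw [← eq_intCast (Int.castRingHom ℝ), RingHom.map_det, RingHom.mapMatrix_apply,
      groundedLapMatrix_map]
    rfl
  rw [hc] at hd
  have h : (162500 : ℝ) * ((G.groundedLapMatrix ℤ v).det : ℝ) = 50 ^ 1730 * 65 ^ 1520 := by
    rw [← hd]
    norm_num
  exact_mod_cast h

lemma card_criticalGroup (hG : G.IsMoore 57 2) :
    162500 * Nat.card G.CriticalGroup = 50 ^ 1730 * 65 ^ 1520 := by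
  obtain ⟨v⟩ := hG.nonempty
  obtain ⟨e⟩ := hG.nonempty_criticalGroup_equiv v
  have h := hG.det_groundedLapMatrix v
  rw [Nat.card_congr e.toEquiv, card_quotient_range_mulVecLin]
  · have key : ∀ (a b c i j : ℕ) (d : ℤ), a * d = b ^ i * c ^ j →
        a * d.natAbs = b ^ i * c ^ j := by
      intro a b c i j d hd
      simpa [Int.natAbs_mul, Int.natAbs_pow] using congrArg Int.natAbs hd
    exact key 162500 50 65 1730 1520 _ h
  · intro h0
    rw [h0, mul_zero] at h
    exact absurd h.symm (mul_ne_zero (pow_ne_zero _ (by norm_num)) (pow_ne_zero _ (by norm_num)))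

lemma finite_criticalGroup (hG : G.IsMoore 57 2) : Finite G.CriticalGroup := by
  refine Nat.finite_of_card_ne_zero fun h0 => ?_
  have h := hG.card_criticalGroup
  rw [h0, mul_zero] at h
  exact absurd h.symm (mul_ne_zero (pow_ne_zero _ (by norm_num)) (pow_ne_zero _ (by norm_num)))

lemma factorization_card_criticalGroup (hG : G.IsMoore 57 2) :
    (Nat.card G.CriticalGroup).factorization 5 = 4975 := by
  have := hG.finite_criticalGroup
  have h0 : Nat.card G.CriticalGroup ≠ 0 := Nat.card_pos.ne'
  have h := congrArg (fun m => m.factorization 5) hG.card_criticalGroup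
  have key : ∀ a b : ℕ, ¬ 5 ∣ b → (5 ^ a * b).factorization 5 = a := by
    intro a b hb
    rw [Nat.factorization_mul (by positivity) (by rintro rfl; simp at hb), Finsupp.add_apply,
      Nat.prime_five.factorization_pow, Finsupp.single_eq_same,
      Nat.factorization_eq_zero_of_not_dvd hb, add_zero]
  have h1 : Nat.factorization 162500 5 = 5 := key 5 52 (by norm_num)
  have h2 : Nat.factorization 50 5 = 2 := key 2 2 (by norm_num)
  have h3 : Nat.factorization 65 5 = 1 := key 1 13 (by norm_num)
  simp only [Nat.factorization_mul (by norm_num : 162500 ≠ 0) h0,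
    Nat.factorization_mul (pow_ne_zero 1730 (by norm_num : (50 : ℕ) ≠ 0))
      (pow_ne_zero 1520 (by norm_num : (65 : ℕ) ≠ 0)), Nat.factorization_pow, Finsupp.add_apply,
    Finsupp.smul_apply, smul_eq_mul, h1, h2, h3] at h
  -- 2 · 1730 + 1520 - 5 = 4975.
  omega

end SimpleGraph.IsMoore

/-! ### Ranks over a field -/

namespace SimpleGraph

variable {V : Type*} [Fintype V] [DecidableEq V] {G : SimpleGraph V} [DecidableRel G.Adj]

/-- The basis vector at `v` has coordinate sum 1, so it lies outside the image of `L` and adds one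
dimension. -/
lemma finrank_range_groundedLapMatrix {F : Type*} [Field F] (v : V) :
    Module.finrank F (LinearMap.range (G.groundedLapMatrix F v).mulVecLin) =
      (G.lapMatrix F).rank + 1 := by
  have h : LinearMap.range (G.groundedLapMatrix F v).mulVecLin =
      LinearMap.range (G.lapMatrix F).mulVecLin ⊔ F ∙ (Pi.single v 1 : V → F) := by
    ext y
    rw [mem_range_groundedLapMatrix, Submodule.mem_sup]
    constructor
    · rintro ⟨z, s, rfl⟩
      exact ⟨_, ⟨z, rfl⟩, _, Submodule.mem_span_singleton.2 ⟨s, rfl⟩, rfl⟩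
    · rintro ⟨_, ⟨z, rfl⟩, _, hs, rfl⟩
      obtain ⟨s, rfl⟩ := Submodule.mem_span_singleton.1 hs
      exact ⟨z, s, rfl⟩
  have hd : LinearMap.range (G.lapMatrix F).mulVecLin ⊓ F ∙ (Pi.single v 1 : V → F) = ⊥ := by
    rw [eq_bot_iff]
    rintro _ ⟨⟨z, rfl⟩, hs⟩
    obtain ⟨s, hs⟩ := Submodule.mem_span_singleton.1 hs
    have h0 := sum_lapMatrix_mulVec (G := G) z
    rw [← mulVecLin_apply, ← hs] at h0
    simp only [Pi.smul_apply, ← Finset.smul_sum] at h0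
    rw [show ∑ i, (Pi.single v 1 : V → F) i = 1 by simp, smul_eq_mul, mul_one] at h0
    rw [Submodule.mem_bot, ← hs, h0, zero_smul]
  have hs := Submodule.finrank_sup_add_finrank_inf_eq (LinearMap.range (G.lapMatrix F).mulVecLin)
    (F ∙ (Pi.single v 1 : V → F))
  rw [hd, finrank_bot, add_zero, finrank_span_singleton (by simp), ← h] at hs
  exact hs

/-- The Laplacian of the sum-zero projection of a vector, modulo the all-ones vector. Its range
is the image of the sum-zero vectors. -/
def lapModOnes (G : SimpleGraph V) [DecidableRel G.Adj] (F : Type*) [Field F] (v : V) :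
    (V → F) →ₗ[F] (V → F) ⧸ F ∙ (1 : V → F) :=
  (F ∙ (1 : V → F)).mkQ ∘ₗ (G.lapMatrix F).mulVecLin ∘ₗ sumZeroProj F v

namespace IsMoore

variable {k : ℕ}

/-- Here `L² = J`. One dimension is lost in restricting `L` to sum-zero vectors, since `L e` is not
killed by `L` while the restricted image is. The other is lost in the quotient, since the all-ones
vector `L (L e)` lies in the restricted image. -/
lemma finrank_range_lapModOnes (hG : G.IsMoore k 2) {F : Type*} [Field F] (v : V)
    (hk : (k ^ 2 + 1 : F) = 0) (hk' : (2 * k + 1 : F) = 0) :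
    Module.finrank F (LinearMap.range (G.lapModOnes F v)) + 2 = (G.lapMatrix F).rank := by
  have hLL : ∀ x : V → F, G.lapMatrix F *ᵥ (G.lapMatrix F *ᵥ x) = (∑ i, x i) • 1 := by
    intro x
    rw [hG.lapMatrix_mulVec_mulVec, hk, hk']
    simp
  have h1 : (1 : V → F) ≠ 0 := fun h => one_ne_zero (congrFun h v)
  set T := (G.lapMatrix F).mulVecLin ∘ₗ sumZeroProj F v with hT
  set e : V → F := Pi.single v 1
  have hsum : ∑ i, e i = 1 := by simp [e]
  have hLe : G.lapMatrix F *ᵥ (G.lapMatrix F *ᵥ e) = 1 := by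
    rw [hLL, hsum, one_smul]
  have hT0 : ∀ y ∈ LinearMap.range T, G.lapMatrix F *ᵥ y = 0 := by
    rintro _ ⟨x, rfl⟩
    rw [hT, LinearMap.comp_apply, mulVecLin_apply, hLL, sum_sumZeroProj, zero_smul]
  have hsup : LinearMap.range (G.lapMatrix F).mulVecLin =
      LinearMap.range T ⊔ F ∙ (G.lapMatrix F *ᵥ e) := by
    apply le_antisymm
    · rintro _ ⟨x, rfl⟩
      refine Submodule.mem_sup.2 ⟨T x, ⟨x, rfl⟩, (∑ i, x i) • (G.lapMatrix F *ᵥ e),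
        Submodule.mem_span_singleton.2 ⟨_, rfl⟩, ?_⟩
      rw [hT, LinearMap.comp_apply, mulVecLin_apply, mulVecLin_apply, ← mulVec_smul, ← mulVec_add,
        sumZeroProj_apply, sub_add_cancel]
    · refine sup_le (LinearMap.range_comp_le_range _ _) ?_
      rw [Submodule.span_singleton_le_iff_mem]
      exact ⟨e, rfl⟩
  have hinf : LinearMap.range T ⊓ F ∙ (G.lapMatrix F *ᵥ e) = ⊥ := by
    rw [eq_bot_iff]
    rintro y ⟨hy, hs⟩
    obtain ⟨s, rfl⟩ := Submodule.mem_span_singleton.1 hs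
    have := hT0 _ hy
    rw [mulVec_smul, hLe, smul_eq_zero, or_iff_left h1] at this
    rw [this, zero_smul]
    exact Submodule.zero_mem _
  have hs := Submodule.finrank_sup_add_finrank_inf_eq (LinearMap.range T)
    (F ∙ (G.lapMatrix F *ᵥ e))
  rw [hinf, finrank_bot, add_zero, finrank_span_singleton (fun h => h1 (by
    rw [← hLe, h, mulVec_zero])), ← hsup] at hs
  have h1T : F ∙ (1 : V → F) ≤ LinearMap.range T := by
    rw [Submodule.span_singleton_le_iff_mem]
    refine ⟨G.lapMatrix F *ᵥ e, ?_⟩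
    rw [hT, LinearMap.comp_apply, sumZeroProj_of_sum_eq_zero v (sum_lapMatrix_mulVec e),
      mulVecLin_apply, hLe]
  have hr : LinearMap.range (G.lapModOnes F v) = (LinearMap.range T).map (F ∙ (1 : V → F)).mkQ := by
    rw [lapModOnes, LinearMap.range_comp]
  have hq := ((F ∙ (1 : V → F)).mkQ.domRestrict (LinearMap.range T)).finrank_range_add_finrank_ker
  rw [LinearMap.range_domRestrict, ← hr, LinearMap.ker_domRestrict, Submodule.ker_mkQ,
    (Submodule.comapSubtypeEquivOfLe h1T).finrank_eq, finrank_span_singleton h1] at hq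
  rw [Matrix.rank, hs, ← hq]

end IsMoore

end SimpleGraph

/-! ### Multiples and torsion in a cokernel, by reduction modulo `n` -/

section CardCoker

variable {R : Type*} [CommRing R] {M N : Type*} [AddCommGroup M] [Module R M] [AddCommGroup N]

/-- Both sides are the index of one subgroup of `M`: multiplication by `n` into `M ⧸ S` has the same
kernel as `f`. -/
lemma card_range_nsmul_quotient (S : Submodule R M) (n : ℕ) (f : M →+ N)
    (hf : ∀ x, f x = 0 ↔ n • x ∈ S) :
    Nat.card {x : M ⧸ S // ∃ y, n • y = x} = Nat.card f.range := by
  let g : M →+ M ⧸ S := (nsmulAddMonoidHom n).comp S.mkQ.toAddMonoidHom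
  have h1 : Nat.card {x : M ⧸ S // ∃ y, n • y = x} = Nat.card g.range := by
    refine Nat.card_congr (Equiv.subtypeEquivRight fun x => ?_)
    constructor
    · rintro ⟨y, rfl⟩
      obtain ⟨y, rfl⟩ := Submodule.Quotient.mk_surjective _ y
      exact ⟨y, rfl⟩
    · rintro ⟨y, rfl⟩
      exact ⟨_, rfl⟩
  have hk : g.ker = f.ker := by
    ext x
    rw [AddMonoidHom.mem_ker, AddMonoidHom.mem_ker, hf, ← Submodule.Quotient.mk_eq_zero]
    rfl
  rw [h1, ← AddSubgroup.index_ker, ← AddSubgroup.index_ker, hk]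

/-- In a finite group multiplication by `n` has kernel and cokernel of equal size, and here the
cokernel is `M / (S + n M)`, identified with `N` by `f`. -/
lemma card_ker_nsmul_quotient (S : Submodule R M) [Finite (M ⧸ S)] (n : ℕ) (f : M →+ N)
    (hs : Function.Surjective f) (hf : ∀ x, f x = 0 ↔ ∃ y, x - n • y ∈ S) :
    Nat.card {x : M ⧸ S // n • x = 0} = Nat.card N := by
  have h1 := card_ker_nsmul_mul_card_range_nsmul (A := M ⧸ S) n
  have h2 := (nsmulAddMonoidHom (α := M ⧸ S) n).range.card_mul_index
  have h3 : (nsmulAddMonoidHom (α := M ⧸ S) n).range.index = Nat.card N := by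
    rw [← AddSubgroup.index_comap_of_surjective _ (f := S.mkQ.toAddMonoidHom) S.mkQ_surjective,
      ← Nat.card_congr (AddSubgroup.topEquiv (G := N)).toEquiv,
      ← AddMonoidHom.range_eq_top.2 hs, ← AddSubgroup.index_ker]
    congr 1
    ext x
    rw [AddMonoidHom.mem_ker, hf, AddSubgroup.mem_comap]
    constructor
    · rintro ⟨y, hy⟩
      obtain ⟨y, rfl⟩ := Submodule.Quotient.mk_surjective _ y
      refine ⟨y, (Submodule.Quotient.eq _).1 (Eq.trans hy.symm ?_)⟩
      rfl
    · rintro ⟨y, hy⟩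
      refine ⟨Submodule.Quotient.mk y, ((Submodule.Quotient.eq _).2 hy).symm⟩
  have hpos : 0 < Nat.card (nsmulAddMonoidHom (α := M ⧸ S) n).range := Nat.card_pos
  rw [h3] at h2
  refine Nat.eq_of_mul_eq_mul_right hpos ?_
  rw [mul_comm (Nat.card N), h2]
  exact h1

end CardCoker

lemma exists_int_comp_cast_eq {ι : Type*} {n : ℕ} (x : ι → ZMod n) :
    ∃ y : ι → ℤ, Int.castRingHom (ZMod n) ∘ y = x :=
  ⟨fun i => (ZMod.intCast_surjective (x i)).choose, funext fun i =>
    (ZMod.intCast_surjective (x i)).choose_spec⟩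

lemma int_comp_cast_eq_zero_iff {ι : Type*} {n : ℕ} (x : ι → ℤ) :
    Int.castRingHom (ZMod n) ∘ x = 0 ↔ ∃ y : ι → ℤ, x = n • y := by
  constructor
  · intro h
    have h' : ∀ i, ∃ c, x i = n * c := fun i =>
      (ZMod.intCast_zmod_eq_zero_iff_dvd (x i) n).1 (congrFun h i)
    choose y hy using h'
    exact ⟨y, funext fun i => by simp [hy]⟩
  · rintro ⟨y, rfl⟩
    ext i
    simp

/-! ### Five-torsion and multiples of 650 in the critical group -/

namespace SimpleGraph

variable {V : Type*} [Fintype V] [DecidableEq V] {G : SimpleGraph V} [DecidableRel G.Adj]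

/-- Reduction modulo `n` of integer vectors. -/
def modVec (V : Type*) (n : ℕ) : (V → ℤ) →+ (V → ZMod n) :=
  (Int.castRingHom (ZMod n)).toAddMonoidHom.compLeft V

omit [Fintype V] [DecidableEq V] in
lemma modVec_apply {n : ℕ} (x : V → ℤ) : modVec V n x = Int.castRingHom (ZMod n) ∘ x := rfl

omit [Fintype V] [DecidableEq V] in
lemma modVec_eq_zero_iff {n : ℕ} (x : V → ℤ) : modVec V n x = 0 ↔ ∃ y : V → ℤ, x = n • y :=
  int_comp_cast_eq_zero_iff x

omit [Fintype V] [DecidableEq V] in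
lemma modVec_surjective (n : ℕ) : Function.Surjective (modVec V n) := exists_int_comp_cast_eq

omit [DecidableEq V] in
lemma modVec_mulVec {n : ℕ} (M : Matrix V V ℤ) (x : V → ℤ) :
    modVec V n (M *ᵥ x) = M.map (Int.castRingHom (ZMod n)) *ᵥ modVec V n x := by
  ext i
  rw [modVec_apply, Function.comp_apply, RingHom.map_mulVec, modVec_apply]

lemma modVec_sumZeroProj {n : ℕ} (v : V) (x : V → ℤ) :
    modVec V n (sumZeroProj ℤ v x) = sumZeroProj (ZMod n) v (modVec V n x) := by
  ext i
  by_cases h : i = v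
  · subst h; simp [modVec_apply, sumZeroProj_apply]
  · simp [modVec_apply, sumZeroProj_apply, h]

namespace IsMoore

lemma card_ker_five_nsmul (hG : G.IsMoore 57 2) :
    Nat.card {x : G.CriticalGroup // 5 • x = 0} = 5 ^ (3249 - (G.lapMatrix (ZMod 5)).rank) := by
  have := hG.finite_criticalGroup
  have : Fact (Nat.Prime 5) := ⟨Nat.prime_five⟩
  obtain ⟨v⟩ := hG.nonempty
  obtain ⟨e⟩ := hG.nonempty_criticalGroup_equiv v
  have := Finite.of_equiv _ e.toEquiv
  set M := G.groundedLapMatrix (ZMod 5) v with hM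
  set W := LinearMap.range M.mulVecLin with hW
  rw [e.card_ker_nsmul, card_ker_nsmul_quotient (N := (V → ZMod 5) ⧸ W) _ 5
    (W.mkQ.toAddMonoidHom.comp (modVec V 5)) (W.mkQ_surjective.comp (modVec_surjective 5)),
    Module.natCard_eq_pow_finrank (K := ZMod 5), Nat.card_zmod]
  · congr 1
    have h1 := W.finrank_quotient_add_finrank
    have h2 : Module.finrank (ZMod 5) W = _ := finrank_range_groundedLapMatrix v
    rw [h2, Module.finrank_fintype_fun_eq_card, hG.card_eq] at h1
    norm_num at h1
    omega
  · intro x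
    change W.mkQ (modVec V 5 x) = 0 ↔ _
    rw [Submodule.mkQ_apply, Submodule.Quotient.mk_eq_zero]
    constructor
    · rintro ⟨z, hz⟩
      obtain ⟨z, rfl⟩ := modVec_surjective 5 z
      rw [mulVecLin_apply, hM, ← groundedLapMatrix_map (Int.castRingHom (ZMod 5)),
        ← modVec_mulVec, eq_comm, ← sub_eq_zero, ← map_sub, modVec_eq_zero_iff] at hz
      obtain ⟨y, hy⟩ := hz
      exact ⟨y, z, by rw [← hy]; simp⟩
    · rintro ⟨y, z, hz⟩
      refine ⟨modVec V 5 z, ?_⟩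
      rw [mulVecLin_apply, hM, ← groundedLapMatrix_map (Int.castRingHom (ZMod 5)),
        ← modVec_mulVec, ← mulVecLin_apply, hz, eq_comm, ← sub_eq_zero, ← map_sub,
        modVec_eq_zero_iff]
      exact ⟨y, by simp⟩

/-- As 650 = 3250/5, divisibility of `650 y` by `L` amounts to a condition on `L y` modulo 5: that
it be constant. -/
lemma card_range_650_nsmul (hG : G.IsMoore 57 2) :
    2 ≤ (G.lapMatrix (ZMod 5)).rank ∧
    Nat.card {x : G.CriticalGroup // ∃ y, 650 • y = x} =
      5 ^ ((G.lapMatrix (ZMod 5)).rank - 2) := by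
  have : Fact (Nat.Prime 5) := ⟨Nat.prime_five⟩
  obtain ⟨v⟩ := hG.nonempty
  obtain ⟨e⟩ := hG.nonempty_criticalGroup_equiv v
  have hr := hG.finrank_range_lapModOnes (F := ZMod 5) v
    (by exact_mod_cast (ZMod.natCast_eq_zero_iff 3250 5).2 (by norm_num))
    (by exact_mod_cast (ZMod.natCast_eq_zero_iff 115 5).2 (by norm_num))
  refine ⟨by omega, ?_⟩
  set f := G.lapModOnes (ZMod 5) v with hf
  have hrange : Nat.card (f.toAddMonoidHom.comp (modVec V 5)).range =
      5 ^ ((G.lapMatrix (ZMod 5)).rank - 2) := by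
    have h1 : Nat.card (LinearMap.range f) = 5 ^ ((G.lapMatrix (ZMod 5)).rank - 2) := by
      rw [Module.natCard_eq_pow_finrank (K := ZMod 5), Nat.card_zmod, ← hr, Nat.add_sub_cancel]
    rw [← h1]
    refine Nat.card_congr (Equiv.subtypeEquivRight fun x => ?_)
    constructor
    · rintro ⟨y, rfl⟩
      exact ⟨modVec V 5 y, rfl⟩
    · rintro ⟨y, rfl⟩
      obtain ⟨y, rfl⟩ := modVec_surjective 5 y
      exact ⟨y, rfl⟩
  rw [e.card_range_nsmul, card_range_nsmul_quotient _ 650 (f.toAddMonoidHom.comp (modVec V 5)),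
    hrange]
  intro x
  change f (modVec V 5 x) = 0 ↔ _
  rw [← sumZeroProj_mem_range_lapMatrix (G := G)]
  set y := sumZeroProj ℤ v x with hy
  have hysum : ∑ i, y i = 0 := sum_sumZeroProj v x
  have hfy : f (modVec V 5 x) = Submodule.Quotient.mk (modVec V 5 (G.lapMatrix ℤ *ᵥ y)) := by
    rw [modVec_mulVec, lapMatrix_map, hy, modVec_sumZeroProj]
    rfl
  have hL := hG.lapMatrix_mulVec_of_sum_eq_zero hysum
  rw [show (2 * (57 : ℕ) + 1 : ℤ) = 115 by norm_num,
    show ((57 : ℕ) ^ 2 + 1 : ℤ) = 3250 by norm_num] at hL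
  rw [hfy, Submodule.Quotient.mk_eq_zero, Submodule.mem_span_singleton, map_nsmul]
  constructor
  · rintro ⟨c, hc⟩
    obtain ⟨c, rfl⟩ := ZMod.intCast_surjective c
    have h0 : modVec V 5 (G.lapMatrix ℤ *ᵥ y - c • 1) = 0 := by
      rw [map_sub, ← hc, sub_eq_zero]
      ext i
      simp [modVec_apply]
    obtain ⟨w, hw⟩ := (modVec_eq_zero_iff _).1 h0
    -- With `L y = c • 1 + 5 • w`, this is `(115 y - L y + c • 1) / 5`; the constant does not affect
    -- its image under `L`.
    refine ⟨(23 : ℤ) • y - w, ?_⟩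
    have h5 : (5 : ℤ) • (G.lapMatrix ℤ *ᵥ ((23 : ℤ) • y - w)) = (5 : ℤ) • (650 • y) := by
      have h6 : (5 : ℤ) • ((23 : ℤ) • y - w) = (115 : ℤ) • y - G.lapMatrix ℤ *ᵥ y + c • 1 := by
        rw [sub_eq_iff_eq_add] at hw
        rw [hw]
        ext i
        simp
        ring
      rw [← mulVec_smul, h6, mulVec_add, hL, mulVec_smul, lapMatrix_mulVec_one]
      ext i
      simp
      ring
    exact smul_right_injective _ (by norm_num : (5 : ℤ) ≠ 0) h5
  · rintro ⟨z, hz⟩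
    have h1 := hG.lapMatrix_mulVec_mulVec z
    rw [hz, mulVec_smul] at h1
    -- Evaluating `L² z` with `L z = 650 y` shows that `L y - 115 y + 5 z` is a constant vector, so
    -- `L y` is constant modulo 5.
    have h2 : ∀ i, 650 * ((G.lapMatrix ℤ *ᵥ y) i - 115 * y i + 5 * z i) = ∑ j, z j := by
      intro i
      have := congrFun h1 i
      simp at this
      linarith
    set c := (G.lapMatrix ℤ *ᵥ y) v - 115 * y v + 5 * z v with hc
    refine ⟨c, ?_⟩
    have h3 : G.lapMatrix ℤ *ᵥ y - c • 1 = 5 • ((23 : ℤ) • y - z) := by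
      ext i
      have := (h2 i).trans (h2 v).symm
      rw [← hc] at this
      simp
      linarith
    have h4 := (modVec_eq_zero_iff _).2 ⟨_, h3⟩
    rw [map_sub, sub_eq_zero] at h4
    rw [h4]
    ext i
    simp [modVec_apply]

end IsMoore

end SimpleGraph

/-- The second alternative always holds: `650 • K` is the image of the sum-zero vectors under the
Laplacian over `ZMod 5` modulo the all-ones vector, which has dimension `e₀ - 2`, so exactly
`e₀ - 2` of the cyclic factors have order `5 ^ 3`. -/
theorem theoremB {V : Type*} [Fintype V] [DecidableEq V] (G : SimpleGraph V)
    [DecidableRel G.Adj] (hG : G.IsMoore 57 2)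
    {F : Type*} [Field F] [CharP F 5] (e₀ : ℕ) (he₀ : e₀ = (G.lapMatrix F).rank)
    (P : Sylow 5 (Multiplicative G.CriticalGroup)) :
    (3 ≤ e₀ ∧ e₀ ≤ 1520 ∧
      Nonempty (P ≃* Multiplicative ((Fin (1520 - e₀) → ZMod 5) ×
        (Fin (1732 - e₀) → ZMod (5 ^ 2)) × (Fin (e₀ - 3) → ZMod (5 ^ 3))))) ∨
    (2 ≤ e₀ ∧ e₀ ≤ 1521 ∧
      Nonempty (P ≃* Multiplicative ((Fin (1521 - e₀) → ZMod 5) ×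
        (Fin (1730 - e₀) → ZMod (5 ^ 2)) × (Fin (e₀ - 2) → ZMod (5 ^ 3))))) := by
  have : Fact (Nat.Prime 5) := ⟨Nat.prime_five⟩
  have hfin := hG.finite_criticalGroup
  have hrank : (G.lapMatrix (ZMod 5)).rank = e₀ := by
    rw [he₀, ← SimpleGraph.lapMatrix_map (ZMod.castHom dvd_rfl F), Matrix.rank_map_of_field]
  -- Makes the natural subtraction in `3249 - e₀` exact.
  have hle : e₀ + 1 ≤ 3250 := by
    obtain ⟨v⟩ := hG.nonempty
    rw [he₀, ← SimpleGraph.finrank_range_groundedLapMatrix v]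
    exact ((G.groundedLapMatrix F v).rank_le_card_width).trans_eq hG.card_eq
  have hkill : ∀ x : G.CriticalGroup, 3250 • x = 0 := hG.nsmul_criticalGroup
  have hmem : ∀ x : G.CriticalGroup, Multiplicative.ofAdd x ∈ P ↔ 125 • x = 0 := by
    intro x
    exact P.mem_iff_pow_eq_one (n := 3) (m := 26) (fun y => hkill y.toAdd) (by norm_num) _
  let A := Additive P
  have hP : Nat.card A = 5 ^ 4975 := by
    have h := P.card_eq_multiplicity
    rw [Nat.card_congr (Multiplicative.toAdd (α := G.CriticalGroup)),
      hG.factorization_card_criticalGroup] at h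
    exact h
  let val : A →+ G.CriticalGroup := MonoidHom.toAdditiveLeft (Subgroup.subtype P.1)
  have hval : Function.Injective val := Subtype.val_injective
  have hval' : ∀ x : G.CriticalGroup, 125 • x = 0 → ∃ a, val a = x :=
    fun x hx => ⟨Additive.ofMul ⟨Multiplicative.ofAdd x, (hmem x).2 hx⟩, rfl⟩
  have hA : ∀ a : A, 5 ^ 3 • a = 0 := fun a =>
    hval (by rw [map_nsmul, map_zero]; exact (hmem _).1 a.toMul.2)
  have h5 : Nat.card {x : A // 5 • x = 0} = 5 ^ (3249 - e₀) := by
    rw [← hrank, ← hG.card_ker_five_nsmul]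
    refine Nat.card_congr (Equiv.ofBijective
      (fun a => ⟨val a.1, by rw [← map_nsmul, a.2, map_zero]⟩) ⟨?_, ?_⟩)
    · intro a b hab
      have h : val a.1 = val b.1 := by simpa only [Subtype.mk.injEq] using hab
      exact Subtype.ext (hval h)
    · rintro ⟨x, hx⟩
      obtain ⟨a, rfl⟩ := hval' x (by rw [show 125 = 25 * 5 by norm_num, mul_smul, hx, smul_zero])
      exact ⟨⟨a, hval (by rw [map_nsmul, hx, map_zero])⟩, rfl⟩
  have h25 : Nat.card {x : A // ∃ y, 25 • y = x} = 5 ^ (e₀ - 2) := by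
    rw [← hrank, ← hG.card_range_650_nsmul.2]
    refine Nat.card_congr (Equiv.ofBijective (fun a => ⟨val a.1, ?_⟩) ⟨?_, ?_⟩)
    · obtain ⟨_, y, rfl⟩ := a
      -- 101 inverts 26 modulo 125, so 650 · 101 = 25 · 26 · 101 acts as 25 on the Sylow subgroup.
      refine ⟨101 • val y, ?_⟩
      rw [smul_smul, show 650 * 101 = 25 + 525 * 5 ^ 3 by norm_num, add_smul, mul_smul,
        ← map_nsmul val (5 ^ 3), hA, map_zero, smul_zero, add_zero, map_nsmul]
    · intro a b hab
      have h : val a.1 = val b.1 := by simpa only [Subtype.mk.injEq] using hab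
      exact Subtype.ext (hval h)
    · rintro ⟨_, y, rfl⟩
      -- Since 125 · 26 = 3250 kills `K`, `26 • y` lies in the Sylow subgroup, and `650 • y = 25 •
      -- (26 • y)`.
      obtain ⟨a, ha⟩ := hval' (26 • y) (by rw [smul_smul]; exact hkill y)
      refine ⟨⟨25 • a, a, rfl⟩, Subtype.ext ?_⟩
      change val (25 • a) = _
      rw [map_nsmul, ha, smul_smul]
      rfl
  obtain ⟨a, b, c, ⟨e⟩⟩ := AddCommGroup.exists_equiv_of_pow_three_nsmul Nat.prime_five hA
  obtain ⟨c1, c2, c3⟩ := e.cards_of_zmod_five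
  have d1 := Nat.pow_right_injective (by norm_num : 2 ≤ 5) (c1.symm.trans hP)
  have d2 := Nat.pow_right_injective (by norm_num : 2 ≤ 5) (c2.symm.trans h5)
  have d3 := Nat.pow_right_injective (by norm_num : 2 ≤ 5) (c3.symm.trans h25)
  have h2 := hG.card_range_650_nsmul.1
  rw [hrank] at h2
  -- Solves `a + 2b + 3c = 4975`, `a + b + c = 3249 - e₀`, `c = e₀ - 2`; the bound `e₀ ≤ 1521` comes
  -- from `a ≥ 0`.
  obtain rfl : a = 1521 - e₀ := by omega
  obtain rfl : b = 1730 - e₀ := by omega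
  obtain rfl : c = e₀ - 2 := by omega
  exact Or.inr ⟨h2, by omega, ⟨AddEquiv.toMultiplicative e⟩⟩
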